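/- All graphs are simple. A graph is chordal if every cycle with at least four vertices has a chord, that is, an edge joining two vertices of the cycle that is not an edge of the cycle. For a chordal graph $G$, the clique graph $C(G)$ has the (inclusion-wise) maximal cliques of $G$ as its vertices, and two distinct maximal cliques are adjacent if and only if they intersect. The reduced clique graph $C_R(G)$ has the same vertices, and two distinct maximal cliques $C, C'$ are adjacent in $C_R(G)$ if and only if $C\cap C'\neq\emptyset$ and there is no path of $G$ from a vertex of $C\setminus C'$ to a vertex of $C'\setminus C$ with no internal vertex in $C\cap C'$. Let $P_n$ be the path with $n$ vertices, and let $G\boxtimes H$ be the join of $G$ and $H$: their disjoint union together with all edges between a vertex of $G$ and a vertex of $H$. 1. For all integers $m,n\ge 1$ there is a finite chordal graph $G$ such that $P_m\boxtimes P_n\cong C_R(G)$. 2. For every integer $n\ge 22$ there is no chordal graph $G$, finite or infinite, such that $P_n\boxtimes P_n\cong C(G)$. 3. The classes of clique graphs and of reduced clique graphs of chordal graphs are incomparable up to isomorphism: there is a finite chordal graph $G$ such that $C(G)\not\cong C_R(G')$ for every chordal graph $G'$, finite or infinite, and there is a finite chordal graph $G$ such that $C_R(G)\not\cong C(G')$ for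 every chordal graph $G'$, finite or infinite. -/

import Mathlib

universe u v

namespace ReducedCliqueGraph

/-- A graph is chordal if every cycle with at least four vertices has a chord: an edge of the graph
joining two vertices of the cycle that is not an edge of the cycle. -/
def IsChordal {V : Type u} (G : SimpleGraph V) : Prop :=
  ∀ (a : V) (c : G.Walk a a), c.IsCycle → 4 ≤ c.length →
    ∃ x ∈ c.support, ∃ y ∈ c.support, G.Adj x y ∧ s(x, y) ∉ c.edges

/-- The type of maximal (with respect to inclusion) cliques of `G`. -/
abbrev MaxClique {V : Type u} (G : SimpleGraph V) : Type u :=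
  {C : Set V // Maximal G.IsClique C}

/-- A walk is `S`-avoiding if none of its internal vertices is in `S` (this is used for paths,
whose internal vertices are the vertices other than the two ends). -/
def IsAvoiding {V : Type u} {G : SimpleGraph V} (S : Set V) {a b : V} (p : G.Walk a b) : Prop :=
  ∀ x ∈ p.support, x ≠ a → x ≠ b → x ∉ S

/-- `C` and `D` form a separating pair in `G`: there is no `(C ∩ D)`-avoiding path from a vertex
of `C - D` to a vertex of `D - C`. -/
def IsSeparatingPair {V : Type u} (G : SimpleGraph V) (C D : Set V) : Prop :=
  ¬ ∃ a ∈ C \ D, ∃ b ∈ D \ C, ∃ p : G.Walk a b, p.IsPath ∧ IsAvoiding (C ∩ D) p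

theorem IsSeparatingPair.symm {V : Type u} {G : SimpleGraph V} {C D : Set V}
    (h : IsSeparatingPair G C D) : IsSeparatingPair G D C := by
  rintro ⟨a, ha, b, hb, p, hp, hS⟩
  refine h ⟨b, hb, a, ha, p.reverse, hp.reverse, fun x hx hxb hxa hxS => ?_⟩
  exact hS x (by simpa using hx) hxa hxb ⟨hxS.2, hxS.1⟩

/-- The clique graph `C(G)`: its vertices are the maximal cliques of `G`, and two distinct maximal
cliques are adjacent iff they intersect. -/
def cliqueGraph {V : Type u} (G : SimpleGraph V) : SimpleGraph (MaxClique G) where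
  Adj C D := C ≠ D ∧ (C.1 ∩ D.1).Nonempty
  symm := ⟨fun _ _ h => ⟨h.1.symm, by rw [Set.inter_comm]; exact h.2⟩⟩
  loopless := ⟨fun _ h => h.1 rfl⟩

/-- The reduced clique graph `C_R(G)`: its vertices are the maximal cliques of `G`, and two
distinct maximal cliques are adjacent iff they intersect and form a separating pair. -/
def reducedCliqueGraph {V : Type u} (G : SimpleGraph V) : SimpleGraph (MaxClique G) where
  Adj C D := C ≠ D ∧ (C.1 ∩ D.1).Nonempty ∧ IsSeparatingPair G C.1 D.1
  symm := ⟨fun _ _ h => ⟨h.1.symm, by rw [Set.inter_comm]; exact h.2.1, h.2.2.symm⟩⟩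
  loopless := ⟨fun _ h => h.1 rfl⟩

/-- The join of `G` and `H`: the disjoint union of `G` and `H` together with all edges between a
vertex of `G` and a vertex of `H`. -/
def join {V : Type u} {W : Type v} (G : SimpleGraph V) (H : SimpleGraph W) :
    SimpleGraph (V ⊕ W) :=
  SimpleGraph.sum G H ⊔ completeBipartiteGraph V W

end ReducedCliqueGraph

/-! Join of paths as a reduced clique graph: cone over two disjoint paths, each with one more vertex
than asked. The maximal cliques are the path edges together with the apex. Two edges of one path
give a separating pair exactly when they are consecutive, and edges of different paths always do,
because deleting the apex disconnects the paths.

Join of paths as a clique graph: suppose it is $C(G)$ with $G$ chordal. For a maximal clique $K$,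
all maximal cliques disjoint from $K$ lie in one component $Q_K$ of $G-K$, and any two of these
components meet. By `IsChordal.exists_complete_vertex`, some $x\in Q_K$ is adjacent to every vertex
of $K$ with a neighbour in $Q_K$. A maximal clique $K'$ containing $x$ and those vertices has
$Q_{K'}\subseteq Q_K$ and is met by $Q_K$ but not by $Q_{K'}$. Choosing $K$ with as few cliques
meeting $Q_K$ as possible gives a contradiction.

Incomparability: one direction combines the two facts above. For the other, reduced clique graphs
have no induced pentagon (`not_induced_pentagon`), while the clique graph of the 5-sun has one. -/

namespace ReducedCliqueGraph

/-! ### Separating pairs in terms of reachability -/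

section Linked

variable {V : Type u} {G : SimpleGraph V}

/-- `b` can be reached from `a` by a walk of `G` that avoids `S` (ends included). -/
def ReachOutside (G : SimpleGraph V) (S : Set V) (a b : V) : Prop :=
  ∃ p : G.Walk a b, ∀ z ∈ p.support, z ∉ S

theorem ReachOutside.refl {S : Set V} {a : V} (ha : a ∉ S) : ReachOutside G S a a :=
  ⟨SimpleGraph.Walk.nil, by simpa using ha⟩

theorem ReachOutside.symm {S : Set V} {a b : V} (h : ReachOutside G S a b) :
    ReachOutside G S b a := by
  obtain ⟨p, hp⟩ := h
  exact ⟨p.reverse, by simpa using hp⟩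

theorem ReachOutside.trans {S : Set V} {a b c : V} (h : ReachOutside G S a b)
    (h' : ReachOutside G S b c) : ReachOutside G S a c := by
  obtain ⟨p, hp⟩ := h
  obtain ⟨q, hq⟩ := h'
  refine ⟨p.append q, fun z hz => ?_⟩
  rcases SimpleGraph.Walk.mem_support_append_iff p q |>.1 hz with h | h
  exacts [hp z h, hq z h]

theorem ReachOutside.of_adj {S : Set V} {a b : V} (h : G.Adj a b) (ha : a ∉ S) (hb : b ∉ S) :
    ReachOutside G S a b :=
  ⟨h.toWalk, by simp [ha, hb]⟩

theorem ReachOutside.left_notMem {S : Set V} {a b : V} (h : ReachOutside G S a b) : a ∉ S := by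
  obtain ⟨p, hp⟩ := h
  exact hp _ p.start_mem_support

theorem ReachOutside.right_notMem {S : Set V} {a b : V} (h : ReachOutside G S a b) : b ∉ S :=
  h.symm.left_notMem

theorem ReachOutside.mono {S T : Set V} {a b : V} (hST : S ⊆ T) (h : ReachOutside G T a b) :
    ReachOutside G S a b := by
  obtain ⟨p, hp⟩ := h
  exact ⟨p, fun z hz hzS => hp z hz (hST hzS)⟩

theorem ReachOutside.of_isClique {S C : Set V} (hC : G.IsClique C) {a b : V} (ha : a ∈ C)
    (hb : b ∈ C) (haS : a ∉ S) (hbS : b ∉ S) : ReachOutside G S a b := by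
  by_cases h : a = b
  · subst h; exact .refl haS
  · exact .of_adj (hC ha hb h) haS hbS

/-- A set of vertices that no edge of `G - S` leaves is closed under reachability outside `S`. -/
theorem ReachOutside.mem_of_closed {S P : Set V}
    (hP : ∀ x ∈ P, ∀ y, x ∉ S → y ∉ S → G.Adj x y → y ∈ P) {a b : V}
    (h : ReachOutside G S a b) (ha : a ∈ P) : b ∈ P := by
  obtain ⟨p, hp⟩ := h
  induction p with
  | nil => exact ha
  | cons h q ih =>
    simp only [SimpleGraph.Walk.support_cons, List.mem_cons, forall_eq_or_imp] at hp
    exact ih (hP _ ha _ hp.1 (hp.2 _ q.start_mem_support) h) hp.2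

/-- `C` and `D` have vertices that can be joined outside `S`. -/
def Linked (G : SimpleGraph V) (S C D : Set V) : Prop :=
  ∃ a ∈ C, ∃ b ∈ D, ReachOutside G S a b

theorem Linked.symm {S C D : Set V} (h : Linked G S C D) : Linked G S D C := by
  obtain ⟨a, ha, b, hb, hab⟩ := h
  exact ⟨b, hb, a, ha, hab.symm⟩

/-- The two vertices reached in the middle clique lie outside `S` and are equal or adjacent. -/
theorem Linked.trans {S C D E : Set V} (hD : G.IsClique D) (h : Linked G S C D)
    (h' : Linked G S D E) : Linked G S C E := by
  obtain ⟨a, ha, b, hb, hab⟩ := h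
  obtain ⟨c, hc, d, hd, hcd⟩ := h'
  exact ⟨a, ha, d, hd,
    hab.trans ((ReachOutside.of_isClique hD hb hc hab.right_notMem hcd.left_notMem).trans hcd)⟩

theorem Linked.of_mem {S C D : Set V} {y : V} (hC : y ∈ C) (hD : y ∈ D) (hS : y ∉ S) :
    Linked G S C D :=
  ⟨y, hC, y, hD, .refl hS⟩

/-- A vertex of one clique outside `C ∩ D` lies outside the other clique, so the ends need no
separate condition; bypassing turns walks into paths. -/
theorem isSeparatingPair_iff_not_linked {C D : Set V} :
    IsSeparatingPair G C D ↔ ¬ Linked G (C ∩ D) C D := by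
  classical
  refine not_congr ⟨?_, ?_⟩
  · rintro ⟨a, ha, b, hb, p, -, hS⟩
    refine ⟨a, ha.1, b, hb.1, p, fun x hx hxS => ?_⟩
    by_cases hxa : x = a
    · exact ha.2 (hxa ▸ hxS.2)
    by_cases hxb : x = b
    · exact hb.2 (hxb ▸ hxS.1)
    exact hS x hx hxa hxb hxS
  · rintro ⟨a, ha, b, hb, p, hp⟩
    refine ⟨a, ⟨ha, fun h => hp a p.start_mem_support ⟨ha, h⟩⟩, b,
      ⟨hb, fun h => hp b p.end_mem_support ⟨h, hb⟩⟩, p.bypass, p.bypass_isPath,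
      fun x hx _ _ => hp x (p.support_bypass_subset_support hx)⟩

end Linked

/-! ### Reduced clique graphs have no induced pentagon -/

section InducedPentagon

variable {V : Type u} {G : SimpleGraph V}

theorem not_linked_of_reducedCliqueGraph_adj {C D : MaxClique G}
    (h : (reducedCliqueGraph G).Adj C D) : ¬ Linked G (C.1 ∩ D.1) C.1 D.1 :=
  isSeparatingPair_iff_not_linked.1 h.2.2

/-- Intersecting cliques that are not adjacent are linked outside their intersection, hence outside
any smaller set. -/
theorem linked_of_not_reducedCliqueGraph_adj {C D : MaxClique G} {S : Set V} (hne : C ≠ D)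
    (h : ¬ (reducedCliqueGraph G).Adj C D) (hS : S.Nonempty) (hC : S ⊆ C.1) (hD : S ⊆ D.1) :
    Linked G S C.1 D.1 := by
  by_contra hl
  refine h ⟨hne, hS.mono (Set.subset_inter hC hD), isSeparatingPair_iff_not_linked.2 ?_⟩
  rintro ⟨a, ha, b, hb, hab⟩
  exact hl ⟨a, ha, b, hb, hab.mono (Set.subset_inter hC hD)⟩

/-- On an induced path of a reduced clique graph, the intersections of consecutive cliques are
equal or incomparable. -/
theorem inter_subset_of_inter_subset {C D E : MaxClique G} (hCD : (reducedCliqueGraph G).Adj C D)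
    (hne : C ≠ E) (hCE : ¬ (reducedCliqueGraph G).Adj C E) (hsub : C.1 ∩ D.1 ⊆ D.1 ∩ E.1) :
    D.1 ∩ E.1 ⊆ C.1 ∩ D.1 := by
  intro y hy
  by_contra hyS
  have h1 : Linked G (C.1 ∩ D.1) C.1 E.1 :=
    linked_of_not_reducedCliqueGraph_adj hne hCE hCD.2.1 Set.inter_subset_left
      (hsub.trans Set.inter_subset_right)
  -- Through `y`, the link from `C` to `E` continues to `D`.
  exact not_linked_of_reducedCliqueGraph_adj hCD
    (h1.trans E.2.1 (Linked.of_mem hy.2 hy.1 hyS))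

/-- If `D` and `E` are adjacent and no other pair among `C, D, E, F` that involves `C` or `F`,
apart from `C, D` and `E, F`, is adjacent, then `C` and `F` do not both contain `D ∩ E`. -/
theorem not_three_inter_eq {C D E F : MaxClique G} (hDE : (reducedCliqueGraph G).Adj D E)
    (hCE : C ≠ E) (hCE' : ¬ (reducedCliqueGraph G).Adj C E)
    (hDF : D ≠ F) (hDF' : ¬ (reducedCliqueGraph G).Adj D F)
    (hCF : C ≠ F) (hCF' : ¬ (reducedCliqueGraph G).Adj C F)
    (hC : D.1 ∩ E.1 ⊆ C.1) (hF : D.1 ∩ E.1 ⊆ F.1) : False := by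
  have hne := hDE.2.1
  have h1 := linked_of_not_reducedCliqueGraph_adj hCE hCE' hne hC Set.inter_subset_right
  have h2 := linked_of_not_reducedCliqueGraph_adj hDF hDF' hne Set.inter_subset_left hF
  have h3 := linked_of_not_reducedCliqueGraph_adj hCF hCF' hne hC hF
  -- Each step of the chain `D`, `F`, `C`, `E` is a nonadjacent pair sharing `D ∩ E`, so `D` and `E`
  -- are linked outside it.
  exact not_linked_of_reducedCliqueGraph_adj hDE
    ((h2.trans F.2.1 h3.symm).trans C.2.1 h1)

/-- No reduced clique graph has an induced cycle on five vertices. -/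
theorem not_induced_pentagon (K : Fin 5 → MaxClique G)
    (hadj : ∀ i, (reducedCliqueGraph G).Adj (K i) (K (i + 1)))
    (hne : ∀ i, K i ≠ K (i + 2)) (hnadj : ∀ i, ¬ (reducedCliqueGraph G).Adj (K i) (K (i + 2))) :
    False := by
  have h11 : ∀ i : Fin 5, i + 1 + 1 = i + 2 := by decide
  have h12 : ∀ i : Fin 5, i + 1 + 2 = i + 3 := by decide
  have h21 : ∀ i : Fin 5, i + 2 + 1 = i + 3 := by decide
  have h31 : ∀ i : Fin 5, i + 3 + 1 = i + 4 := by decide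
  have h32 : ∀ i : Fin 5, i + 3 + 2 = i := by decide
  have h41 : ∀ i : Fin 5, i + 4 + 1 = i := by decide
  let A : Fin 5 → Set V := fun i => (K i).1 ∩ (K (i + 1)).1
  have hl : ∀ i, A i ⊆ (K i).1 := fun i => Set.inter_subset_left
  have hr : ∀ i, A i ⊆ (K (i + 1)).1 := fun i => Set.inter_subset_right
  have up : ∀ i, A i ⊆ A (i + 1) → A (i + 1) ⊆ A i := fun i h =>
    inter_subset_of_inter_subset (hadj i) (by rw [h11]; exact hne i)
      (by rw [h11]; exact hnadj i) h
  have down : ∀ i, A (i + 1) ⊆ A i → A i ⊆ A (i + 1) := by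
    intro i h
    have := inter_subset_of_inter_subset (hadj (i + 1)).symm
      (by rw [h11]; exact (hne i).symm) (by rw [h11]; exact fun h => hnadj i h.symm)
      (by rw [Set.inter_comm (K (i + 1 + 1)).1, Set.inter_comm (K (i + 1)).1 (K i).1]; exact h)
    rw [Set.inter_comm (K (i + 1 + 1)).1, Set.inter_comm (K (i + 1)).1 (K i).1] at this
    exact this
  have three : ∀ i, A i = A (i + 1) → A (i + 1) = A (i + 2) → False := by
    intro i h1 h2
    refine not_three_inter_eq (C := K i) (F := K (i + 3)) (hadj (i + 1)) ?_ ?_ ?_ ?_ ?_ ?_ ?_ ?_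
    · rw [h11]; exact hne i
    · rw [h11]; exact hnadj i
    · rw [← h12]; exact hne (i + 1)
    · rw [← h12]; exact hnadj (i + 1)
    · have := hne (i + 3)
      rw [h32] at this; exact this.symm
    · have := hnadj (i + 3)
      rw [h32] at this; exact fun h => this h.symm
    · exact h1.symm.subset.trans (hl i)
    · rw [← h21]; exact h2.subset.trans (hr (i + 2))
  -- Such an inclusion puts `A i` inside `K (i + 2)`, hence inside `A (i + 1)`, and forces three
  -- consecutive equalities.
  have skip : ∀ i, ¬ A i ⊆ A (i + 2) := by
    intro i h
    have h1 : A i ⊆ A (i + 1) :=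
      Set.subset_inter (hr i) (by rw [h11]; exact h.trans (hl _))
    have h1' := h1.antisymm (up i h1)
    have h2 : A (i + 1) ⊆ A (i + 1 + 1) := by rw [h11, ← h1']; exact h
    have h2' := h2.antisymm (up _ h2)
    rw [h11] at h2'
    exact three i h1' h2'
  have skip' : ∀ i, ¬ A (i + 2) ⊆ A i := by
    intro i h
    have h1 : A (i + 1 + 1) ⊆ A (i + 1) := by
      rw [h11]
      exact Set.subset_inter (h.trans (hr i)) (by rw [h11]; exact hl _)
    have h1' := (down _ h1).antisymm h1
    have h2 : A (i + 1) ⊆ A i := by rw [h1', h11]; exact h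
    have h2' := (down _ h2).antisymm h2
    rw [h11] at h1'
    exact three i h2' h1'
  -- Otherwise the four other intersections link `K i` to `K (i + 1)` the long way round, outside `A
  -- i`.
  have around : ∀ i, A (i + 1) ⊆ A i ∨ A (i + 2) ⊆ A i ∨ A (i + 3) ⊆ A i ∨ A (i + 4) ⊆ A i := by
    intro i
    by_contra! h
    obtain ⟨h1, h2, h3, h4⟩ := h
    have link : ∀ j, ¬ A j ⊆ A i → Linked G (A i) (K j).1 (K (j + 1)).1 := by
      intro j hj
      obtain ⟨y, hy, hyS⟩ := Set.not_subset.1 hj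
      exact Linked.of_mem hy.1 hy.2 hyS
    have l1 := link _ h1
    have l2 := link _ h2
    have l3 := link _ h3
    have l4 := link _ h4
    rw [h11] at l1
    rw [h21] at l2
    rw [h31] at l3
    rw [h41] at l4
    exact not_linked_of_reducedCliqueGraph_adj (hadj i)
      (((l1.trans (K _).2.1 l2).trans (K _).2.1 l3).trans (K _).2.1 l4).symm
  have alt : ∀ i, A i = A (i + 1) ∨ A (i + 4) = A i := by
    intro i
    rcases around i with h | h | h | h
    · exact .inl ((down i h).antisymm h)
    · exact (skip' i h).elim
    · have := skip (i + 3)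
      rw [h32] at this
      exact (this h).elim
    · right
      have := up (i + 4)
      rw [h41] at this
      exact h.antisymm (this h)
  have a0 := alt 0
  have a1 := alt 1
  have a2 := alt 2
  have a3 := alt 3
  have a4 := alt 4
  have t0 := three 0
  have t1 := three 1
  have t2 := three 2
  have t3 := three 3
  have t4 := three 4
  simp only [Fin.reduceAdd] at a0 a1 a2 a3 a4 t0 t1 t2 t3 t4
  -- Each `A i` equals a cyclic neighbour; five being odd, some three consecutive ones are equal.
  tauto

end InducedPentagon

/-! ### Chordality from an elimination order -/

section Elimination

/-- A graph is chordal if its vertices are linearly ordered so that the later neighbours of each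
vertex form a clique. -/
theorem isChordal_of_later_neighbors {V : Type u} [LinearOrder V] {G : SimpleGraph V}
    (h : ∀ v x y, v < x → v < y → G.Adj v x → G.Adj v y → x ≠ y → G.Adj x y) : IsChordal G := by
  classical
  -- If the cycle starts at its least vertex, the two cycle neighbours of that vertex span the
  -- chord.
  have base : ∀ (a : V) (c : G.Walk a a), c.IsCycle → 4 ≤ c.length → (∀ z ∈ c.support, a ≤ z) →
      ∃ x ∈ c.support, ∃ y ∈ c.support, G.Adj x y ∧ s(x, y) ∉ c.edges := by
    intro a c hc hlen hmin
    have hnil : ¬ c.Nil := hc.not_nil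
    have h1 := c.adj_snd hnil
    have h2 := (c.adj_penultimate hnil).symm
    have m1 : c.snd ∈ c.support := c.getVert_mem_support 1
    have m2 : c.penultimate ∈ c.support := c.getVert_mem_support _
    refine ⟨c.snd, m1, c.penultimate, m2, h a _ _ (lt_of_le_of_ne (hmin _ m1) h1.ne)
      (lt_of_le_of_ne (hmin _ m2) h2.ne) h1 h2 hc.snd_ne_penultimate, fun he => ?_⟩
    obtain ⟨i, hi, he⟩ := (SimpleGraph.Walk.mk_mem_edges_iff_exists c).1 he
    have inj : ∀ i j, i ≤ c.length - 1 → j ≤ c.length - 1 → c.getVert i = c.getVert j → i = j :=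
      fun i j hi hj => hc.getVert_injOn' hi hj
    rcases Sym2.eq_iff.1 he with ⟨e1, e2⟩ | ⟨e1, e2⟩
    · have i1 := inj i 1 (by lia) (by lia) e1
      subst i1
      have := inj 2 (c.length - 1) (by lia) (by lia) e2
      lia
    · have i1 := inj i (c.length - 1) (by lia) (by lia) e1
      rw [i1, Nat.sub_add_cancel (by lia), c.getVert_length] at e2
      exact h1.ne e2
  intro a c hc hlen
  obtain ⟨m, hm, hmin⟩ := c.support.toFinset.exists_min_image id ⟨a, by simp⟩
  simp only [List.mem_toFinset, id] at hm hmin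
  obtain ⟨x, hx, y, hy, hxy, he⟩ := base m (c.rotate m hm) (hc.rotate hm) (by simpa using hlen)
    (fun z hz => hmin z ((c.mem_support_rotate_iff m hm).1 hz))
  exact ⟨x, (c.mem_support_rotate_iff m hm).1 hx, y, (c.mem_support_rotate_iff m hm).1 hy, hxy,
    fun h' => he ((c.rotate_edges m hm).mem_iff.2 h')⟩

end Elimination

/-! ### The 5-sun -/

section Sun

/-- The adjacency of the 5-sun: the vertices `5, …, 9` form a clique, and `i < 5` is joined to
`5 + i` and to its cyclic successor in that clique. -/
def sunAdj (x y : Fin 10) : Bool :=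
  (5 ≤ x.1 && 5 ≤ y.1 && x.1 != y.1) ||
  (x.1 < 5 && (y.1 == 5 + x.1 || y.1 == 5 + (x.1 + 1) % 5)) ||
  (y.1 < 5 && (x.1 == 5 + y.1 || x.1 == 5 + (y.1 + 1) % 5))

/-- The 5-sun. -/
def sun : SimpleGraph (Fin 10) where
  Adj x y := sunAdj x y = true
  symm := ⟨by decide⟩
  loopless := ⟨by decide⟩

theorem isChordal_sun : IsChordal sun := by
  apply isChordal_of_later_neighbors
  change ∀ v x y : Fin 10, v < x → v < y → sunAdj v x = true → sunAdj v y = true → x ≠ y →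
    sunAdj x y = true
  decide

/-- A vertex whose neighbours are pairwise adjacent determines a maximal clique. -/
theorem maximal_isClique_of_simplicial {V : Type u} {G : SimpleGraph V} {C : Set V} {v : V}
    (hC : G.IsClique C) (hv : v ∈ C) (hN : ∀ x, G.Adj v x → x ∈ C) : Maximal G.IsClique C := by
  refine ⟨hC, fun D hD hCD x hx => ?_⟩
  by_cases h : v = x
  · exact h ▸ hv
  · exact hN x (hD (hCD hv) hx h)

/-- The closed neighbourhood of the vertex `i < 5` of the 5-sun. -/
def sunTriangle (i : Fin 5) : MaxClique sun :=
  ⟨{x | x.1 = i.1 ∨ x.1 = 5 + i.1 ∨ x.1 = 5 + (i.1 + 1) % 5}, by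
    have hi := i.2
    refine maximal_isClique_of_simplicial (v := ⟨i.1, by lia⟩) ?_ (.inl rfl) ?_
    · intro x hx y hy hne
      revert i x y
      change ∀ i : Fin 5, _ → ∀ x : Fin 10, (x.1 = i.1 ∨ x.1 = 5 + i.1 ∨ x.1 = 5 + (i.1 + 1) % 5) →
        ∀ y : Fin 10, (y.1 = i.1 ∨ y.1 = 5 + i.1 ∨ y.1 = 5 + (i.1 + 1) % 5) → x ≠ y →
        sunAdj x y = true
      decide
    · intro x hx
      change x.1 = i.1 ∨ x.1 = 5 + i.1 ∨ x.1 = 5 + (i.1 + 1) % 5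
      change sunAdj _ x = true at hx
      revert i x
      decide⟩

theorem mem_sunTriangle {i : Fin 5} {x : Fin 10} :
    x ∈ (sunTriangle i).1 ↔ x.1 = i.1 ∨ x.1 = 5 + i.1 ∨ x.1 = 5 + (i.1 + 1) % 5 := Iff.rfl

theorem sunTriangle_injective : Function.Injective sunTriangle := by
  intro i j h
  have hi : (⟨i.1, by lia⟩ : Fin 10) ∈ (sunTriangle j).1 := h ▸ mem_sunTriangle.2 (.inl rfl)
  rw [mem_sunTriangle] at hi
  dsimp only at hi
  ext
  lia

theorem cliqueGraph_sun_adj (i : Fin 5) :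
    (cliqueGraph sun).Adj (sunTriangle i) (sunTriangle (i + 1)) := by
  have hne : ∀ i : Fin 5, i ≠ i + 1 := by decide
  refine ⟨fun h => hne i (sunTriangle_injective h),
    ⟨5 + (i.1 + 1) % 5, by lia⟩, mem_sunTriangle.2 ?_, mem_sunTriangle.2 ?_⟩ <;>
  · revert i
    decide

theorem cliqueGraph_sun_not_adj (i : Fin 5) :
    ¬ (cliqueGraph sun).Adj (sunTriangle i) (sunTriangle (i + 2)) := by
  rintro ⟨-, x, h1, h2⟩
  rw [mem_sunTriangle] at h1 h2
  revert i x
  decide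

/-- The clique graph of the 5-sun is not a reduced clique graph. -/
theorem isEmpty_cliqueGraph_sun_iso {V : Type u} (G : SimpleGraph V) :
    IsEmpty (cliqueGraph sun ≃g reducedCliqueGraph G) := by
  have hne : ∀ i : Fin 5, i ≠ i + 2 := by decide
  refine ⟨fun e => not_induced_pentagon (fun i => e (sunTriangle i)) (fun i => ?_) (fun i h => ?_)
    (fun i h => ?_)⟩
  · exact e.map_adj_iff.2 (cliqueGraph_sun_adj i)
  · exact hne i (sunTriangle_injective (e.injective h))
  · exact cliqueGraph_sun_not_adj i (e.map_adj_iff.1 h)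

end Sun

/-! ### The cone over two paths -/

section PathJoin

/-- The cone over two disjoint paths with `m + 1` and `n + 1` vertices: the paths are `0, …, m` and
`m + 1, …, m + n + 1`, and `m + n + 2` is the apex. -/
def pathsCone (m n : ℕ) : SimpleGraph (Fin (m + n + 3)) where
  Adj x y := x ≠ y ∧ (x.1 = m + n + 2 ∨ y.1 = m + n + 2 ∨ (x.1 + 1 = y.1 ∧ x.1 ≠ m) ∨
    (y.1 + 1 = x.1 ∧ y.1 ≠ m))
  symm := ⟨fun x y h => ⟨h.1.symm, by tauto⟩⟩
  loopless := ⟨fun _ h => h.1 rfl⟩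

theorem pathsCone_adj {m n : ℕ} {x y : Fin (m + n + 3)} :
    (pathsCone m n).Adj x y ↔ x.1 ≠ y.1 ∧ (x.1 = m + n + 2 ∨ y.1 = m + n + 2 ∨
      (x.1 + 1 = y.1 ∧ x.1 ≠ m) ∨ (y.1 + 1 = x.1 ∧ y.1 ≠ m)) := by
  rw [← Fin.ext_iff.ne]
  rfl

/-- In the natural order, the later neighbours of `v` are among `v + 1` and the apex. -/
theorem isChordal_pathsCone (m n : ℕ) : IsChordal (pathsCone m n) := by
  apply isChordal_of_later_neighbors
  intro v x y hx hy hvx hvy hne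
  rw [pathsCone_adj] at *
  rw [Fin.lt_def] at hx hy
  rw [ne_eq, Fin.ext_iff] at hne
  lia

/-- The clique formed by an edge `{i, i + 1}` of one of the paths and the apex. -/
def coneClique (m n i : ℕ) : Set (Fin (m + n + 3)) :=
  {x | x.1 = i ∨ x.1 = i + 1 ∨ x.1 = m + n + 2}

variable {m n i j : ℕ}

theorem mem_coneClique {x : Fin (m + n + 3)} :
    x ∈ coneClique m n i ↔ x.1 = i ∨ x.1 = i + 1 ∨ x.1 = m + n + 2 := Iff.rfl

theorem isClique_coneClique (hm : i ≠ m) : (pathsCone m n).IsClique (coneClique m n i) := by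
  intro x hx y hy hne
  rw [mem_coneClique] at hx hy
  rw [pathsCone_adj]
  rw [ne_eq, Fin.ext_iff] at hne
  lia

theorem maximal_coneClique (hm : i ≠ m) (hi : i ≤ m + n) :
    Maximal (pathsCone m n).IsClique (coneClique m n i) := by
  refine ⟨isClique_coneClique hm, fun D hD hCD x hx => ?_⟩
  have h1 : (⟨i, by lia⟩ : Fin (m + n + 3)) ∈ D := hCD (.inl rfl)
  have h2 : (⟨i + 1, by lia⟩ : Fin (m + n + 3)) ∈ D := hCD (.inr (.inl rfl))
  by_contra hxC
  rw [mem_coneClique] at hxC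
  have a1 := pathsCone_adj.1 (hD h1 hx (by rw [ne_eq, Fin.ext_iff]; dsimp only; lia))
  have a2 := pathsCone_adj.1 (hD h2 hx (by rw [ne_eq, Fin.ext_iff]; dsimp only; lia))
  dsimp only at a1 a2
  lia

/-- The least non-apex vertex `x` of `D` leaves room only for `x + 1` and the apex. If `x` ends its
path, the edge before it serves; it exists since `m, n ≥ 1`. -/
theorem exists_subset_coneClique (hm : 1 ≤ m) (hn : 1 ≤ n) {D : Set (Fin (m + n + 3))}
    (hD : (pathsCone m n).IsClique D) : ∃ i, i ≠ m ∧ i ≤ m + n ∧ D ⊆ coneClique m n i := by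
  classical
  have key : ∀ x ∈ D, ∀ y ∈ D, x.1 < y.1 → y.1 = m + n + 2 ∨ (x.1 + 1 = y.1 ∧ x.1 ≠ m) := by
    intro x hx y hy hlt
    have := pathsCone_adj.1 (hD hx hy (by rw [ne_eq, Fin.ext_iff]; lia))
    lia
  by_cases hne : ∃ x ∈ D, x.1 ≠ m + n + 2
  · obtain ⟨x, ⟨hx, hxN⟩, hmin⟩ := (Set.toFinite {x ∈ D | x.1 ≠ m + n + 2}).exists_minimalFor
      (fun x => x.1) _ hne
    have hle : ∀ y ∈ D, y.1 ≠ m + n + 2 → x.1 ≤ y.1 := by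
      intro y hy hyN
      by_contra h
      exact h (hmin ⟨hy, hyN⟩ (by lia))
    have hx2 := x.2
    by_cases h1 : x.1 = m ∨ x.1 = m + n + 1
    · refine ⟨x.1 - 1, by lia, by lia, fun y hy => ?_⟩
      have k := key x hx y hy
      have l := hle y hy
      have hy2 := y.2
      rw [mem_coneClique]
      lia
    · refine ⟨x.1, by lia, by lia, fun y hy => ?_⟩
      have k := key x hx y hy
      have l := hle y hy
      rw [mem_coneClique]
      lia
  · push Not at hne
    exact ⟨0, by lia, by lia, fun y hy => .inr (.inr (hne y hy))⟩

/-- Walk along one path without the apex; `h` keeps `i` and `j` on the same path. -/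
theorem reachOutside_of_le (hij : i ≤ j) (hj : j ≤ m + n + 1) (h : i ≤ m → j ≤ m) :
    ReachOutside (pathsCone m n) {x | x.1 = m + n + 2} ⟨i, by lia⟩ ⟨j, by lia⟩ := by
  induction j, hij using Nat.le_induction with
  | base => exact .refl (by simp; lia)
  | succ j hij ih =>
    refine (ih (by lia) (by lia)).trans (.of_adj ?_ (by simp; lia) (by simp; lia))
    rw [pathsCone_adj]
    dsimp only
    lia

/-- Two maximal cliques of the cone over two paths form a separating pair iff they come from
consecutive edges of a path or from different paths. -/
theorem isSeparatingPair_coneClique (him : i ≠ m) (hjm : j ≠ m) (hij : i < j) (hj : j ≤ m + n) :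
    IsSeparatingPair (pathsCone m n) (coneClique m n i) (coneClique m n j) ↔
      (i + 1 = j ∨ (i < m ∧ m < j)) := by
  rw [isSeparatingPair_iff_not_linked]
  constructor
  · intro h
    by_contra hc
    refine h ⟨⟨i + 1, by lia⟩, .inr (.inl rfl), ⟨j, by lia⟩, .inl rfl, ?_⟩
    refine ReachOutside.mono ?_ (reachOutside_of_le (by lia) (by lia) (by lia))
    rintro x ⟨hx, hy⟩
    rw [mem_coneClique] at hx hy
    rw [Set.mem_ofPred_eq]
    lia
  · rintro h ⟨a, ha, b, hb, hab⟩
    have hbS := hab.right_notMem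
    have haS := hab.left_notMem
    rw [Set.mem_inter_iff, mem_coneClique, mem_coneClique] at hbS haS
    rw [mem_coneClique] at ha hb
    -- For consecutive edges the cut is just before the shared vertex `i + 1`; otherwise it lies
    -- between the two paths.
    have : b ∈ {x : Fin (m + n + 3) | x.1 ≤ (if i + 1 = j then i else m)} := by
      refine hab.mem_of_closed ?_ ?_
      · intro x hx y hxS hyS hxy
        rw [Set.mem_inter_iff, mem_coneClique, mem_coneClique] at hxS hyS
        rw [pathsCone_adj] at hxy
        rw [Set.mem_ofPred_eq] at hx ⊢
        split_ifs at * <;> lia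
      · rw [Set.mem_ofPred_eq]
        split_ifs <;> lia
    rw [Set.mem_ofPred_eq] at this
    split_ifs at this <;> lia

/-- The first vertex of the edge that corresponds to a vertex of the join. -/
def coneIndex (m n : ℕ) : Fin m ⊕ Fin n → ℕ
  | .inl i => i.1
  | .inr j => m + 1 + j.1

theorem coneIndex_ne (x : Fin m ⊕ Fin n) : coneIndex m n x ≠ m := by
  rcases x with i | j <;> simp only [coneIndex] <;> lia

theorem coneIndex_le (x : Fin m ⊕ Fin n) : coneIndex m n x ≤ m + n := by
  rcases x with i | j <;> simp only [coneIndex] <;> lia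

theorem coneIndex_injective : Function.Injective (coneIndex m n) := by
  rintro (i | i) (j | j) h <;> simp only [coneIndex] at h
  · rw [Fin.ext h]
  · lia
  · lia
  · rw [Fin.ext (by lia : i.1 = j.1)]

theorem exists_coneIndex_eq (him : i ≠ m) (hi : i ≤ m + n) : ∃ x, coneIndex m n x = i := by
  by_cases h : i < m
  · exact ⟨.inl ⟨i, h⟩, rfl⟩
  · exact ⟨.inr ⟨i - (m + 1), by lia⟩, by simp only [coneIndex]; lia⟩

/-- The indices skip `m`, so consecutive indices always belong to one path. -/
theorem join_pathGraph_adj {x y : Fin m ⊕ Fin n} :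
    (join (SimpleGraph.pathGraph m) (SimpleGraph.pathGraph n)).Adj x y ↔
      (coneIndex m n x + 1 = coneIndex m n y ∨ coneIndex m n y + 1 = coneIndex m n x ∨
        (coneIndex m n x < m ∧ m < coneIndex m n y) ∨
        (coneIndex m n y < m ∧ m < coneIndex m n x)) := by
  rcases x with i | i <;> rcases y with j | j <;>
  · simp [join, coneIndex, SimpleGraph.pathGraph_adj]
    try lia

theorem coneClique_injective (hi : i ≤ m + n) (hj : j ≤ m + n)
    (h : coneClique m n i = coneClique m n j) : i = j := by
  have h1 : (⟨i, by lia⟩ : Fin (m + n + 3)) ∈ coneClique m n j := h ▸ .inl rfl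
  have h2 : (⟨j, by lia⟩ : Fin (m + n + 3)) ∈ coneClique m n i := h ▸ .inl rfl
  rw [mem_coneClique] at h1 h2
  dsimp only at h1 h2
  lia

/-- The maximal clique of the cone that corresponds to a vertex of the join. -/
def coneMaxClique (m n : ℕ) (x : Fin m ⊕ Fin n) : MaxClique (pathsCone m n) :=
  ⟨coneClique m n (coneIndex m n x), maximal_coneClique (coneIndex_ne x) (coneIndex_le x)⟩

theorem coneMaxClique_injective : Function.Injective (coneMaxClique m n) := fun x y h =>
  coneIndex_injective
    (coneClique_injective (coneIndex_le x) (coneIndex_le y) (congrArg Subtype.val h))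

theorem coneMaxClique_surjective (hm : 1 ≤ m) (hn : 1 ≤ n) :
    Function.Surjective (coneMaxClique m n) := by
  intro D
  obtain ⟨i, him, hi, hsub⟩ := exists_subset_coneClique hm hn D.2.1
  obtain ⟨x, rfl⟩ := exists_coneIndex_eq him hi
  exact ⟨x, Subtype.ext ((D.2.2 (isClique_coneClique him) hsub).antisymm hsub)⟩

theorem reducedCliqueGraph_pathsCone_adj_of_lt {x y : Fin m ⊕ Fin n}
    (hxy : coneIndex m n x < coneIndex m n y) :
    (reducedCliqueGraph (pathsCone m n)).Adj (coneMaxClique m n x) (coneMaxClique m n y) ↔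
      (join (SimpleGraph.pathGraph m) (SimpleGraph.pathGraph n)).Adj x y := by
  have hne : coneMaxClique m n x ≠ coneMaxClique m n y := fun h =>
    hxy.ne (congrArg (coneIndex m n) (coneMaxClique_injective h))
  have hcap : ((coneMaxClique m n x).1 ∩ (coneMaxClique m n y).1).Nonempty :=
    ⟨⟨m + n + 2, by lia⟩, .inr (.inr rfl), .inr (.inr rfl)⟩
  have hs := isSeparatingPair_coneClique (coneIndex_ne x) (coneIndex_ne y) hxy (coneIndex_le y)
  rw [join_pathGraph_adj]
  constructor
  · intro h
    have := hs.1 h.2.2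
    lia
  · intro h
    exact ⟨hne, hcap, hs.2 (by lia)⟩

/-- The join of two paths is the reduced clique graph of the cone over two paths. -/
theorem nonempty_join_iso_reducedCliqueGraph (hm : 1 ≤ m) (hn : 1 ≤ n) :
    Nonempty (join (SimpleGraph.pathGraph m) (SimpleGraph.pathGraph n) ≃g
      reducedCliqueGraph (pathsCone m n)) := by
  refine ⟨⟨Equiv.ofBijective (coneMaxClique m n)
    ⟨coneMaxClique_injective, coneMaxClique_surjective hm hn⟩, ?_⟩⟩
  intro x y
  change (reducedCliqueGraph _).Adj (coneMaxClique m n x) (coneMaxClique m n y) ↔ _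
  rcases lt_trichotomy (coneIndex m n x) (coneIndex m n y) with h | h | h
  · exact reducedCliqueGraph_pathsCone_adj_of_lt h
  · rw [coneIndex_injective h]
    simp
  · rw [SimpleGraph.adj_comm, reducedCliqueGraph_pathsCone_adj_of_lt h, SimpleGraph.adj_comm]

end PathJoin

/-! ### Cliques and components in chordal graphs -/

section Chordal

variable {V : Type u} {G : SimpleGraph V}

/-- A chord of a walk shortens it. -/
theorem exists_shorter_walk_of_chord {a b x y : V} (p : G.Walk a b) (hx : x ∈ p.support)
    (hy : y ∈ p.support) (hxy : G.Adj x y) (he : s(x, y) ∉ p.edges) :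
    ∃ q : G.Walk a b, q.length < p.length ∧ q.support ⊆ p.support := by
  classical
  have forward : ∀ x y (q : G.Walk a x) (r : G.Walk x b), q.append r = p → y ∈ r.support →
      G.Adj x y → s(x, y) ∉ p.edges →
      ∃ q : G.Walk a b, q.length < p.length ∧ q.support ⊆ p.support := by
    rintro x y q r rfl hy hxy he
    -- A segment of length one would be the edge `s(x, y)` itself.
    have hlen : 2 ≤ (r.takeUntil y hy).length := by
      by_contra! hlt
      have hmem : s(x, y) ∈ (r.takeUntil y hy).edges := by
        generalize r.takeUntil y hy = t at hlt
        cases t with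
        | nil => exact (hxy.ne rfl).elim
        | cons h t =>
          cases t with
          | nil => simp
          | cons h' t => simp at hlt
      rw [SimpleGraph.Walk.edges_append, List.mem_append] at he
      exact he (.inr (r.edges_takeUntil_subset_edges hy hmem))
    refine ⟨q.append (.cons hxy (r.dropUntil y hy)), ?_, ?_⟩
    · have h2 := congrArg SimpleGraph.Walk.length (r.take_spec hy)
      simp only [SimpleGraph.Walk.length_append, SimpleGraph.Walk.length_cons] at h2 ⊢
      lia
    · intro z hz
      rw [SimpleGraph.Walk.mem_support_append_iff] at hz ⊢
      rcases hz with hz | hz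
      · exact .inl hz
      · rw [SimpleGraph.Walk.support_cons, List.mem_cons] at hz
        rcases hz with rfl | hz
        · exact .inl q.end_mem_support
        · exact .inr (r.support_dropUntil_subset_support hy hz)
  have hy' := hy
  rw [← p.take_spec hx, SimpleGraph.Walk.mem_support_append_iff] at hy'
  rcases hy' with hy' | hy'
  · refine forward y x ((p.takeUntil x hx).takeUntil y hy')
      (((p.takeUntil x hx).dropUntil y hy').append (p.dropUntil x hx)) ?_ ?_ hxy.symm
      (by rwa [Sym2.eq_swap])
    · rw [SimpleGraph.Walk.append_assoc, SimpleGraph.Walk.take_spec, SimpleGraph.Walk.take_spec]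
    · exact (SimpleGraph.Walk.mem_support_append_iff _ _).2
        (.inl (SimpleGraph.Walk.end_mem_support _))
  · exact forward x y _ _ (p.take_spec hx) hy' hxy he

/-- In a chordal graph, if `s` and `t` are adjacent and a walk runs from a neighbour of `t` to a
neighbour of `s` without meeting them, then some vertex of the walk is adjacent to both. -/
theorem IsChordal.exists_common_neighbor (hG : IsChordal G) {s t : V} (hst : G.Adj s t) :
    ∀ (n : ℕ) {a b : V} (p : G.Walk a b), p.length = n → G.Adj t a → G.Adj s b →
      s ∉ p.support → t ∉ p.support → ∃ x ∈ p.support, G.Adj x s ∧ G.Adj x t := by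
  classical
  intro n
  induction n using Nat.strong_induction_on with
  | _ n ih =>
    intro a b p hn hta hsb hs ht
    have shorter : ∀ {a' b' : V} (q : G.Walk a' b'), q.length < p.length →
        q.support ⊆ p.support → G.Adj t a' → G.Adj s b' →
        ∃ x ∈ p.support, G.Adj x s ∧ G.Adj x t := by
      intro a' b' q hq hsub ha' hb'
      obtain ⟨x, hx, h⟩ := ih _ (hn ▸ hq) q rfl ha' hb' (fun h => hs (hsub h))
        (fun h => ht (hsub h))
      exact ⟨x, hsub hx, h⟩
    by_cases hp : p.IsPath
    swap
    · refine shorter p.bypass (lt_of_le_of_ne p.length_bypass_le_length fun h => hp ?_)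
        p.support_bypass_subset_support hta hsb
      rw [← p.bypass_eq_self_of_length_le_length_bypass h.ge]
      exact p.bypass_isPath
    by_cases hab : a = b
    · exact ⟨a, p.start_mem_support, hab ▸ hsb.symm, hta.symm⟩
    have hpos : 0 < p.length := by
      by_contra! h
      exact hab (SimpleGraph.Walk.eq_of_length_eq_zero (Nat.le_zero.1 h))
    -- Closing `p` through `t` and `s` gives a cycle of length at least 4. A chord at `t` or `s`
    -- truncates `p`, and one inside `p` shortcuts it.
    let r : G.Walk t s := .cons hta (p.concat hsb.symm)
    have hrs : ∀ z, z ∈ r.support ↔ z = t ∨ z ∈ p.support ∨ z = s := by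
      intro z
      simp [r, SimpleGraph.Walk.support_concat]
    have hre : ∀ e, e ∈ r.edges ↔ e = s(t, a) ∨ e ∈ p.edges ∨ e = s(b, s) := by
      intro e
      simp [r, SimpleGraph.Walk.edges_concat]
    have hrp : r.IsPath := by
      refine (SimpleGraph.Walk.cons_isPath_iff _ _).2 ⟨hp.concat hs _, ?_⟩
      simp [SimpleGraph.Walk.support_concat, ht, hst.ne']
    have hnot : s(s, t) ∉ r.edges := by
      rw [hre]
      rintro (h | h | h)
      · rcases Sym2.eq_iff.1 h with ⟨h, -⟩ | ⟨h, -⟩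
        · exact hst.ne h
        · exact hs (h ▸ p.start_mem_support)
      · exact hs (p.fst_mem_support_of_mem_edges h)
      · rcases Sym2.eq_iff.1 h with ⟨h, -⟩ | ⟨-, h⟩
        · exact hs (h ▸ p.end_mem_support)
        · exact ht (h ▸ p.end_mem_support)
    obtain ⟨x, hx, y, hy, hxy, he⟩ := hG s (.cons hst r)
      ((SimpleGraph.Walk.cons_isCycle_iff _ _).2 ⟨hrp, hnot⟩)
      (by simp [r, SimpleGraph.Walk.length_concat]; lia)
    rw [SimpleGraph.Walk.support_cons, List.mem_cons, hrs] at hx hy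
    rw [SimpleGraph.Walk.edges_cons, List.mem_cons, hre] at he
    push Not at he
    obtain ⟨he1, he2, he3, he4⟩ := he
    have tcase : ∀ z ∈ p.support, G.Adj t z → s(t, z) ≠ s(t, a) →
        ∃ x ∈ p.support, G.Adj x s ∧ G.Adj x t := by
      intro z hz htz hne
      have hza : z ≠ a := fun h => hne (h ▸ rfl)
      exact shorter (p.dropUntil z hz) (p.length_dropUntil_lt_length hz hza)
        (p.support_dropUntil_subset_support hz) htz hsb
    have scase : ∀ z ∈ p.support, G.Adj s z → s(s, z) ≠ s(b, s) →
        ∃ x ∈ p.support, G.Adj x s ∧ G.Adj x t := by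
      intro z hz hsz hne
      have hzb : z ≠ b := fun h => hne (h ▸ Sym2.eq_swap)
      exact shorter (p.takeUntil z hz) (p.length_takeUntil_lt_length hz hzb)
        (p.support_takeUntil_subset_support hz) hta hsz
    have hx' : x = s ∨ x = t ∨ x ∈ p.support := by tauto
    have hy' : y = s ∨ y = t ∨ y ∈ p.support := by tauto
    rcases hx' with rfl | rfl | hx' <;> rcases hy' with rfl | rfl | hy'
    · exact (hxy.ne rfl).elim
    · exact (he1 rfl).elim
    · exact scase y hy' hxy he4
    · exact (he1 Sym2.eq_swap).elim
    · exact (hxy.ne rfl).elim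
    · exact tcase y hy' hxy he2
    · exact scase x hx' hxy.symm (by rwa [Sym2.eq_swap])
    · exact tcase x hx' hxy.symm (by rwa [Sym2.eq_swap])
    · obtain ⟨q, hq, hsub⟩ := exists_shorter_walk_of_chord p hx' hy' hxy he3
      exact shorter q hq hsub hta hsb

theorem exists_maxClique_superset {S : Set V} (hS : G.IsClique S) : ∃ K : MaxClique G, S ⊆ K.1 := by
  obtain ⟨M, hSM, hM⟩ := zorn_subset_nonempty {C | G.IsClique C} (fun c hc hchain _ => by
    refine ⟨⋃₀ c, ?_, fun s hs => Set.subset_sUnion_of_mem hs⟩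
    rintro x ⟨C, hC, hxC⟩ y ⟨D, hD, hyD⟩ hne
    rcases hchain.total hC hD with h | h
    · exact hc hD (h hxC) hyD hne
    · exact hc hC hxC (h hyD) hne) S hS
  exact ⟨⟨M, hM⟩, hSM⟩

/-- Neighbourhoods are thus read off from maximal cliques; if these are finitely many, so are the
traces of neighbourhoods on a set, even for infinite `V`. -/
theorem adj_iff_exists_maxClique {x y : V} (hne : x ≠ y) :
    G.Adj x y ↔ ∃ K : MaxClique G, x ∈ K.1 ∧ y ∈ K.1 := by
  constructor
  · intro h
    obtain ⟨K, hK⟩ := exists_maxClique_superset (G := G) (S := {x, y})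
      (SimpleGraph.isClique_pair.2 fun _ => h)
    exact ⟨K, hK (by simp), hK (by simp)⟩
  · rintro ⟨K, hx, hy⟩
    exact K.2.1 hx hy hne

/-- In a chordal graph with finitely many maximal cliques, if every vertex of a clique `S` has a
neighbour in a connected set `Q` that is disjoint from `S`, then some vertex of `Q` is adjacent to
all of `S`. -/
theorem IsChordal.exists_complete_vertex (hG : IsChordal G) [Finite (MaxClique G)] {Q S : Set V}
    (hQ : Q.Nonempty) (hconn : ∀ x ∈ Q, ∀ y ∈ Q, ReachOutside G Qᶜ x y) (hS : G.IsClique S)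
    (hdisj : ∀ s ∈ S, s ∉ Q) (hnb : ∀ s ∈ S, ∃ q ∈ Q, G.Adj s q) :
    ∃ x ∈ Q, ∀ s ∈ S, G.Adj x s := by
  classical
  let f : V → Set V := fun x => {s ∈ S | G.Adj x s}
  have hfin : (f '' Q).Finite := by
    refine Set.Finite.subset (Set.finite_range
      (fun 𝒦 : Set (MaxClique G) => {s ∈ S | ∃ K ∈ 𝒦, s ∈ K.1})) ?_
    rintro _ ⟨x, hx, rfl⟩
    refine ⟨{K | x ∈ K.1}, ?_⟩
    ext s
    refine and_congr_right fun hs => ?_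
    rw [adj_iff_exists_maxClique fun h : x = s => hdisj s hs (h ▸ hx)]
    rfl
  obtain ⟨x, hxQ, hmax⟩ := Set.Finite.exists_maximalFor' f Q hfin hQ
  refine ⟨x, hxQ, fun s hs => ?_⟩
  by_contra hxs
  -- On a shortest walk in `Q` from `x` to a neighbour of `s`, only the end `y` is adjacent to `s`.
  -- The common neighbour of `s` and any `t ∈ f x` is therefore `y`, so `f y` contains `f x` and
  -- also `s`.
  have hex : ∃ n, ∃ y, ∃ p : G.Walk x y, p.length = n ∧ (∀ z ∈ p.support, z ∈ Q) ∧ G.Adj s y := by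
    obtain ⟨y, hy, hsy⟩ := hnb s hs
    obtain ⟨p, hp⟩ := hconn x hxQ y hy
    exact ⟨_, y, p, rfl, fun z hz => not_not.1 (hp z hz), hsy⟩
  obtain ⟨y, p, hlen, hpQ, hsy⟩ := Nat.find_spec hex
  have hlast : ∀ z ∈ p.support, G.Adj s z → z = y := by
    intro z hz hsz
    by_contra hne
    refine Nat.find_min hex (hlen ▸ p.length_takeUntil_lt_length hz hne)
      ⟨z, p.takeUntil z hz, rfl, fun w hw => hpQ w (p.support_takeUntil_subset_support hz hw), hsz⟩
  have hle : f x ≤ f y := by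
    rintro t ⟨htS, hxt⟩
    refine ⟨htS, ?_⟩
    have hst : s ≠ t := fun h => hxs (h ▸ hxt)
    obtain ⟨z, hz, hzs, hzt⟩ := hG.exists_common_neighbor (hS hs htS hst) _ p rfl hxt.symm hsy
      (fun h => hdisj s hs (hpQ s h)) (fun h => hdisj t htS (hpQ t h))
    exact hlast z hz hzs.symm ▸ hzt
  exact hxs (hmax (hpQ y p.end_mem_support) hle ⟨hs, hsy.symm⟩).2

/-- In a chordal graph with finitely many maximal cliques, it is impossible that, for every maximal
clique `K`, the maximal cliques disjoint from `K` exist and lie in one component `Q K` of `G - K`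
for a reason visible in the clique graph, and that these components intersect pairwise. -/
theorem IsChordal.false_of_disjoint_cliques (hG : IsChordal G) [Finite (MaxClique G)]
    [Nonempty (MaxClique G)]
    (h1 : ∀ K : MaxClique G, ∃ L : MaxClique G, Disjoint L.1 K.1)
    (h2 : ∀ K L M : MaxClique G, Disjoint L.1 K.1 → Disjoint M.1 K.1 →
      ∃ N : MaxClique G, (L.1 ∩ N.1).Nonempty ∧ (M.1 ∩ N.1).Nonempty)
    (h3 : ∀ K K' : MaxClique G, ∃ L L' : MaxClique G, Disjoint L.1 K.1 ∧ Disjoint L'.1 K'.1 ∧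
      (L.1 ∩ L'.1).Nonempty) : False := by
  choose L₀ hL₀ using h1
  obtain ⟨K₁⟩ := ‹Nonempty (MaxClique G)›
  have hne : ∀ K : MaxClique G, (L₀ K).1.Nonempty := by
    intro K
    obtain ⟨N, hN, -⟩ := h2 K (L₀ K) (L₀ K) (hL₀ K) (hL₀ K)
    exact hN.left
  choose v hv using hne
  let Q : MaxClique G → Set V := fun K => {w | ReachOutside G K.1 (v K) w}
  have hvK : ∀ K, v K ∉ K.1 := fun K h => Set.disjoint_left.1 (hL₀ K) (hv K) h
  have hsub : ∀ K L : MaxClique G, Disjoint L.1 K.1 → L.1 ⊆ Q K := by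
    intro K L hL z hz
    obtain ⟨N, ⟨a, ha, haN⟩, b, hb, hbN⟩ := h2 K (L₀ K) L (hL₀ K) hL
    have hn : ∀ {y}, y ∈ L.1 → y ∉ K.1 := fun h => Set.disjoint_left.1 hL h
    have haK : a ∉ K.1 := Set.disjoint_left.1 (hL₀ K) ha
    exact (ReachOutside.of_isClique (L₀ K).2.1 (hv K) ha (hvK K) haK).trans
      ((ReachOutside.of_isClique N.2.1 haN hbN haK (hn hb)).trans
        (.of_isClique L.2.1 hb hz (hn hb) (hn hz)))
  have hclosed : ∀ K x y, x ∈ Q K → G.Adj x y → y ∉ K.1 → y ∈ Q K := fun K x y hx hxy hy =>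
    hx.trans (.of_adj hxy hx.right_notMem hy)
  have hconn : ∀ K, ∀ x ∈ Q K, ∀ y ∈ Q K, ReachOutside G (Q K)ᶜ x y := by
    intro K x hx y hy
    obtain ⟨p, hp⟩ := hx.symm.trans hy
    refine ⟨p, fun z hz => ?_⟩
    classical
    exact not_not.2 (hx.trans ⟨p.takeUntil z hz,
      fun w hw => hp w (p.support_takeUntil_subset_support hz hw)⟩)
  obtain ⟨K, hK⟩ := Finite.exists_min
    (fun K : MaxClique G => {L : MaxClique G | (L.1 ∩ Q K).Nonempty}.ncard)
  let S : Set V := {s ∈ K.1 | ∃ q ∈ Q K, G.Adj s q}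
  have hSK : G.IsClique S := K.2.1.subset fun s hs => hs.1
  obtain ⟨x, hxQ, hxS⟩ := hG.exists_complete_vertex (S := S) ⟨v K, .refl (hvK K)⟩ (hconn K) hSK
    (fun s hs hsQ => hsQ.right_notMem hs.1) (fun s hs => hs.2)
  obtain ⟨K', hK'⟩ := exists_maxClique_superset (hSK.insert fun s hs _ => hxS s hs)
  have hQQ : Q K' ⊆ Q K := by
    obtain ⟨L, L', hL, hL', z, hz, hz'⟩ := h3 K K'
    have hzK := hsub K L hL hz
    have hzK' := hsub K' L' hL' hz'
    -- A walk outside `K'` can leave `Q K` only through a vertex of `S`, but `S ⊆ K'`.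
    intro w hw
    refine (hzK'.symm.trans hw).mem_of_closed (fun a ha b _ hb hab => ?_) hzK
    refine hclosed K a b ha hab fun hbK => hb (hK' (.inr ⟨hbK, a, ha, hab.symm⟩))
  refine (hK K').not_gt (Set.ncard_lt_ncard ⟨?_, ?_⟩)
  · rintro L ⟨y, hy, hyQ⟩
    exact ⟨y, hy, hQQ hyQ⟩
  · intro hle
    obtain ⟨y, hy, hyQ⟩ := hle (show K' ∈ _ from ⟨x, hK' (.inl rfl), hxQ⟩)
    exact hyQ.right_notMem hy

end Chordal

/-! ### The join of two long paths is not a clique graph -/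

section PathJoinClique

variable {V : Type u} {G : SimpleGraph V} {n : ℕ}

/-- The join of two paths with at least seven vertices each is not the clique graph of a chordal
graph. -/
theorem isEmpty_join_iso_cliqueGraph (hn : 7 ≤ n) (hG : IsChordal G) :
    IsEmpty (join (SimpleGraph.pathGraph n) (SimpleGraph.pathGraph n) ≃g cliqueGraph G) := by
  refine ⟨fun e => ?_⟩
  have : Finite (MaxClique G) := Finite.of_equiv _ e.toEquiv
  let o : Fin n := ⟨0, by lia⟩
  have : Nonempty (MaxClique G) := ⟨e (.inl o)⟩
  have hcross : ∀ i j, ((e (.inl i)).1 ∩ (e (.inr j)).1).Nonempty := fun i j =>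
    (e.map_adj_iff.2 (by simp [join])).2
  have hcross' : ∀ i j, ((e (.inr i)).1 ∩ (e (.inl j)).1).Nonempty := fun i j => by
    rw [Set.inter_comm]; exact hcross j i
  have hself : ∀ x, ((e x).1 ∩ (e x).1).Nonempty := by
    rintro (i | i)
    · rw [Set.inter_self]; exact (hcross i o).left
    · rw [Set.inter_self]; exact (hcross o i).right
  have hdisj : ∀ x y, x ≠ y →
      ¬ (join (SimpleGraph.pathGraph n) (SimpleGraph.pathGraph n)).Adj x y →
      Disjoint (e x).1 (e y).1 := by
    intro x y hne h
    by_contra hd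
    exact h (e.map_adj_iff.1
      ⟨fun he => hne (e.injective he), Set.not_disjoint_iff_nonempty_inter.1 hd⟩)
  have hinl : ∀ i j : Fin n, i.1 + 2 ≤ j.1 ∨ j.1 + 2 ≤ i.1 →
      Disjoint (e (.inl i)).1 (e (.inl j)).1 := by
    intro i j hij
    refine hdisj _ _ (fun h => ?_) ?_
    · rw [Sum.inl.inj h] at hij; lia
    · simp [join, SimpleGraph.pathGraph_adj]; lia
  have hinr : ∀ i j : Fin n, i.1 + 2 ≤ j.1 ∨ j.1 + 2 ≤ i.1 →
      Disjoint (e (.inr i)).1 (e (.inr j)).1 := by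
    intro i j hij
    refine hdisj _ _ (fun h => ?_) ?_
    · rw [Sum.inr.inj h] at hij; lia
    · simp [join, SimpleGraph.pathGraph_adj]; lia
  -- Each of `i`, `j` is within distance 1 of at most one of 0, 3, 6, so one of these is far from
  -- both; this is where seven vertices are needed.
  have far : ∀ i j : Fin n, ∃ k : Fin n, (k.1 + 2 ≤ i.1 ∨ i.1 + 2 ≤ k.1) ∧
      (k.1 + 2 ≤ j.1 ∨ j.1 + 2 ≤ k.1) := by
    intro i j
    by_cases h0 : 2 ≤ i.1 ∧ 2 ≤ j.1
    · exact ⟨o, by simp only [o]; lia⟩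
    by_cases h3 : (i.1 ≤ 1 ∨ 5 ≤ i.1) ∧ (j.1 ≤ 1 ∨ 5 ≤ j.1)
    · exact ⟨⟨3, by lia⟩, by dsimp only; lia⟩
    · exact ⟨⟨6, by lia⟩, by dsimp only; lia⟩
  have h3 : ∀ K K' : MaxClique G, ∃ L L' : MaxClique G, Disjoint L.1 K.1 ∧ Disjoint L'.1 K'.1 ∧
      (L.1 ∩ L'.1).Nonempty := by
    intro K K'
    obtain ⟨x, rfl⟩ := e.surjective K
    obtain ⟨y, rfl⟩ := e.surjective K'
    rcases x with i | i <;> rcases y with j | j <;> obtain ⟨k, hi, hj⟩ := far i j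
    · exact ⟨_, _, hinl k i hi, hinl k j hj, hself _⟩
    · exact ⟨_, _, hinl k i hi, hinr k j hj, hcross _ _⟩
    · exact ⟨_, _, hinr k i hi, hinl k j hj, hcross' _ _⟩
    · exact ⟨_, _, hinr k i hi, hinr k j hj, hself _⟩
  refine hG.false_of_disjoint_cliques (fun K => ?_) (fun K L M hL hM => ?_) h3
  · obtain ⟨L, -, hL, -⟩ := h3 K K
    exact ⟨L, hL⟩
  · obtain ⟨x, rfl⟩ := e.surjective K
    obtain ⟨y, rfl⟩ := e.surjective L
    obtain ⟨z, rfl⟩ := e.surjective M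
    -- Cliques from different paths meet, so `L` and `M` come from the same path as `K`, and any
    -- clique of the other path meets both.
    rw [← Set.not_nonempty_iff_eq_empty.trans Set.disjoint_iff_inter_eq_empty.symm] at hL hM
    rcases x with i | i <;> rcases y with j | j <;> rcases z with k | k
    · exact ⟨e (.inr o), hcross _ _, hcross _ _⟩
    · exact (hM (hcross' _ _)).elim
    · exact (hL (hcross' _ _)).elim
    · exact (hL (hcross' _ _)).elim
    · exact (hL (hcross _ _)).elim
    · exact (hL (hcross _ _)).elim
    · exact (hM (hcross _ _)).elim
    · exact ⟨e (.inl o), hcross' _ _, hcross' _ _⟩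

end PathJoinClique

end ReducedCliqueGraph

theorem mainTheorem5 :
    -- the join of two paths is the reduced clique graph of a (finite) chordal graph
    (∀ m n : ℕ, 1 ≤ m → 1 ≤ n →
      ∃ (k : ℕ) (G : SimpleGraph (Fin k)), ReducedCliqueGraph.IsChordal G ∧
        Nonempty (ReducedCliqueGraph.join (SimpleGraph.pathGraph m) (SimpleGraph.pathGraph n) ≃g
          ReducedCliqueGraph.reducedCliqueGraph G)) ∧
    -- for `n ≥ 22`, the join of two paths on `n` vertices is not the clique graph of any chordal
    -- graph
    (∀ n : ℕ, 22 ≤ n → ∀ (V : Type u) (G : SimpleGraph V), ReducedCliqueGraph.IsChordal G →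
      IsEmpty (ReducedCliqueGraph.join (SimpleGraph.pathGraph n) (SimpleGraph.pathGraph n) ≃g
        ReducedCliqueGraph.cliqueGraph G)) ∧
    -- some clique graph of a chordal graph is not the reduced clique graph of any chordal graph
    (∃ (k : ℕ) (G : SimpleGraph (Fin k)), ReducedCliqueGraph.IsChordal G ∧
      ∀ (V : Type u) (G' : SimpleGraph V), ReducedCliqueGraph.IsChordal G' →
        IsEmpty (ReducedCliqueGraph.cliqueGraph G ≃g ReducedCliqueGraph.reducedCliqueGraph G')) ∧
    -- some reduced clique graph of a chordal graph is not the clique graph of any chordal graph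
    (∃ (k : ℕ) (G : SimpleGraph (Fin k)), ReducedCliqueGraph.IsChordal G ∧
      ∀ (V : Type u) (G' : SimpleGraph V), ReducedCliqueGraph.IsChordal G' →
        IsEmpty (ReducedCliqueGraph.reducedCliqueGraph G ≃g
          ReducedCliqueGraph.cliqueGraph G')) := by
  open ReducedCliqueGraph in
  refine ⟨fun m n hm hn => ⟨_, pathsCone m n, isChordal_pathsCone m n,
    nonempty_join_iso_reducedCliqueGraph hm hn⟩,
    fun n hn V G hG => isEmpty_join_iso_cliqueGraph (by lia) hG,
    ⟨_, sun, isChordal_sun, fun V G' _ => isEmpty_cliqueGraph_sun_iso G'⟩,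
    ⟨_, pathsCone 22 22, isChordal_pathsCone 22 22, fun V G' hG' => ⟨fun e => ?_⟩⟩⟩
  obtain ⟨f⟩ := nonempty_join_iso_reducedCliqueGraph (m := 22) (n := 22) (by lia) (by lia)
  exact (isEmpty_join_iso_cliqueGraph (by lia) hG').false (f.trans e)
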